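/- Let $k, n, m, d$ be integers with $2 \le k < n$, $d=\gcd(n,k)$, $n = md$ and $m \ge 3$. Let $\mathbb F_{2^n}$ be the field with $2^n$ elements, let $\mathbb F_{2^d}$ be its subfield with $2^d$ elements, and let $G(x)=x^{2^k+1}$ be the Gold function on $\mathbb F_{2^n}$. For a function $F:\mathbb F_{2^n}\to\mathbb F_{2^n}$ and $c\in\mathbb F_{2^n}$, the $c$-differential uniformity of $F$ is $${}_c\Delta_F=\max\bigl\{\#\{x\in\mathbb F_{2^n} : F(x+a)-cF(x)=b\} \;:\; a,b\in\mathbb F_{2^n},\ a\neq 0 \text{ if } c=1\bigr\}.$$ The function $F$ is called $(c,\delta)$-uniform if ${}_c\Delta_F=\delta$, and almost perfect nonlinear (APN) if ${}_1\Delta_F=2$. Then: 1. If $c\in\mathbb F_{2^d}$ and $c\neq 1$, then ${}_c\Delta_G=\dfrac{2^{\gcd(2k,n)}-1}{2^{\gcd(k,n)}-1}$. 2. If $c\in\mathbb F_{2^n}\setminus\mathbb F_{2^d}$, then ${}_c\Delta_G=2^d+1$. 3. In particular, if $G$ is APN, then $G$ is $(c,3)$-uniform for every $c\in\mathbb F_{2^n}\setminus\{0,1\}$,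 while for $c=0$ it is $(0,3)$-uniform if $n$ is even and $(0,1)$-uniform if $n$ is odd. -/

import Mathlib

/-- The `c`-derivative `x ↦ f (x + a) - c * f x` of `f` with respect to `a`. -/
def cDerivative {F : Type*} [Field F] (f : F → F) (c a x : F) : F :=
  f (x + a) - c * f x

open Classical in
/-- The number of `x` with `f (x + a) - c * f x = b`. -/
noncomputable def cDiffCount {F : Type*} [Field F] [Fintype F] (f : F → F) (c a b : F) : ℕ :=
  (Finset.univ.filter fun x : F => cDerivative f c a x = b).card

open Classical in
/-- The `c`-differential uniformity of `f` on a finite field: the maximum of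
`cDiffCount f c a b` over all `a` and `b`, with `a ≠ 0` required if `c = 1`. -/
noncomputable def cDiffUniformity {F : Type*} [Field F] [Fintype F] (f : F → F) (c : F) : ℕ :=
  (Finset.univ.filter fun p : F × F => c = 1 → p.1 ≠ 0).sup fun p => cDiffCount f c p.1 p.2

/-- `f` is `(c, δ)`-uniform: its `c`-differential uniformity is equal to `δ`. -/
def IsCUniform {F : Type*} [Field F] [Fintype F] (f : F → F) (c : F) (δ : ℕ) : Prop :=
  cDiffUniformity f c = δ

/-- Almost perfect nonlinear functions: the usual differential uniformity (`c = 1`) is `2`. -/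
def IsAPN {F : Type*} [Field F] [Fintype F] (f : F → F) : Prop :=
  IsCUniform f 1 2

/-- The Gold function `x ↦ x ^ (2 ^ k + 1)`. -/
def goldFun (F : Type*) [Field F] (k : ℕ) (x : F) : F :=
  x ^ (2 ^ k + 1)

section GoldFunction

variable {F : Type*} [Field F]

/-! Write q = 2^k. In characteristic 2 the equation to count is (1 - c)x^(q+1) + a x^q + a^q x =
const. If c ≠ 1 is fixed by x ↦ x^q, the shift t = a/(1 - c) completes it to (x + t)^(q+1) = C, so
the maximum is the number of (q+1)-th roots of unity, a gcd (`cDiffUniformity_goldFun_of_pow_eq`).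
For c outside K, sending one root to infinity leaves an affine equation in the Frobenius, whence at
most |K| + 1 roots (`card_projective_poly_le`). The bound is attained: some z^(q+1) + αz + β has
that many roots, and c^q ≠ c lets an affine substitution reach any α ≠ 0
(`le_cDiffUniformity_goldFun`). -/

lemma cDerivative_goldFun [CharP F 2] (k : ℕ) (c a x : F) :
    cDerivative (goldFun F k) c a x =
      (1 - c) * x ^ (2 ^ k + 1) + a * x ^ 2 ^ k + a ^ 2 ^ k * x + a ^ (2 ^ k + 1) := by
  simp only [cDerivative, goldFun, pow_succ _ (2 ^ k), add_pow_char_pow]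
  ring

lemma cDiffUniformity_le [Fintype F] {f : F → F} {c : F} {N : ℕ}
    (h : ∀ a b, cDiffCount f c a b ≤ N) : cDiffUniformity f c ≤ N := by
  classical
  exact Finset.sup_le fun p _ => h p.1 p.2

lemma cDiffCount_le_cDiffUniformity [Fintype F] (f : F → F) {c a : F} (b : F)
    (h : c = 1 → a ≠ 0) : cDiffCount f c a b ≤ cDiffUniformity f c := by
  classical
  unfold cDiffUniformity
  exact Finset.le_sup (f := fun p : F × F => cDiffCount f c p.1 p.2) (b := (a, b))
    (by simpa using h)

/-! ### Upper bound for roots of projective polynomials -/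

/-- An affine equation in the `2 ^ k`-Frobenius has at most as many solutions as there are
elements fixed by that Frobenius. -/
lemma card_frobenius_affine_le [CharP F 2] {k : ℕ} (K : Subfield F) [Finite K]
    (hK : ∀ x : F, x ^ 2 ^ k = x → x ∈ K) {R P e : F} (he : e ≠ 0) (D : Finset F)
    (hD : ∀ t ∈ D, R * t ^ 2 ^ k + P * t + e = 0) : D.card ≤ Nat.card K := by
  classical
  rcases le_or_gt D.card 1 with h1 | h1
  · exact h1.trans Nat.card_pos
  obtain ⟨t₁, ht₁, t₂, ht₂, hne⟩ := Finset.one_lt_card.1 h1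
  have hs : t₂ - t₁ ≠ 0 := sub_ne_zero.2 hne.symm
  have hker : ∀ t ∈ D, R * (t - t₁) ^ 2 ^ k + P * (t - t₁) = 0 := fun t ht => by
    rw [sub_pow_char_pow]
    linear_combination hD t ht - hD t₁ ht₁
  have hR : R ≠ 0 := by
    rintro rfl
    have hP : P = 0 := by simpa [hs] using hker t₂ ht₂
    simpa [hP, he] using hD t₁ ht₁
  -- The kernel of y ↦ R y^q + P y is at most a line: the ratio of a kernel element to a nonzero one
  -- is Frobenius-fixed.
  have hmem : ∀ t ∈ D, (t - t₁) / (t₂ - t₁) ∈ K := fun t ht => hK _ <| by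
    rw [div_pow, div_eq_div_iff (pow_ne_zero _ hs) hs]
    apply mul_left_cancel₀ hR
    linear_combination (t₂ - t₁) * hker t ht - (t - t₁) * hker t₂ ht₂
  rw [← Nat.card_eq_finsetCard D]
  refine Nat.card_le_card_of_injective
    (fun t : D => (⟨(t - t₁) / (t₂ - t₁), hmem t t.2⟩ : K)) ?_
  intro x y hxy
  have := congrArg Subtype.val hxy
  rw [div_left_inj' hs, sub_left_inj] at this
  exact Subtype.ext this

/-- For a root z, put x = z + y and divide by y^(q+1): t = 1/y satisfies an affine equation with
constant term e ≠ 0. -/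
lemma card_projective_poly_le [CharP F 2] {k : ℕ} (K : Subfield F) [Finite K]
    (hK : ∀ x : F, x ^ 2 ^ k = x → x ∈ K) {e A B C : F} (he : e ≠ 0) (S : Finset F)
    (hS : ∀ x ∈ S, e * x ^ (2 ^ k + 1) + A * x ^ 2 ^ k + B * x = C) :
    S.card ≤ Nat.card K + 1 := by
  classical
  rcases S.eq_empty_or_nonempty with rfl | ⟨z, hz⟩
  · simp
  rw [← Finset.card_erase_add_one hz, Nat.add_le_add_iff_right]
  have hinj : Function.Injective fun x : F => (x - z)⁻¹ := fun x y h => by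
    simpa using h
  rw [← Finset.card_image_of_injective _ hinj]
  refine card_frobenius_affine_le (k := k) (R := B + e * z ^ 2 ^ k) (P := A + e * z)
    K hK he _ fun t ht => ?_
  obtain ⟨x, hx, rfl⟩ := Finset.mem_image.1 ht
  obtain ⟨hxz, hxS⟩ := Finset.mem_erase.1 hx
  obtain ⟨y, rfl⟩ : ∃ y, x = y + z := ⟨x - z, by ring⟩
  have hy : y ≠ 0 := by rintro rfl; simp at hxz
  have h1 := hS _ hxS
  have h2 := hS _ hz
  simp only [pow_succ _ (2 ^ k), add_pow_char_pow] at h1 h2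
  have hq : y ^ 2 ^ k ≠ 0 := pow_ne_zero _ hy
  simp only [add_sub_cancel_right, inv_pow]
  field_simp
  linear_combination h1 - h2

/-! ### Sharpness of the bound -/

/-- A polynomial `z ^ (2 ^ k + 1) + α * z + β`, with `α ≠ 0`, that has as many roots as
there are points of the projective line over the field fixed by the `2 ^ k`-Frobenius. -/
lemma exists_projective_poly_card [CharP F 2] {k : ℕ} (K : Subfield F) [Finite K]
    (hK : ∀ x ∈ K, x ^ 2 ^ k = x) {u : F} (hu : u ∉ K) (huK : u ^ 2 ^ k ≠ u)
    (hu2 : (u ^ 2 ^ k) ^ 2 ^ k ≠ u) :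
    ∃ α β : F, α ≠ 0 ∧ ∃ Z : Finset F, Z.card = Nat.card K + 1 ∧
      ∀ z ∈ Z, z ^ (2 ^ k + 1) + α * z + β = 0 := by
  classical
  have := Fintype.ofFinite K
  set v := u ^ 2 ^ k with hv
  set w := v ^ 2 ^ k with hw
  have hvu : v - u ≠ 0 := sub_ne_zero.2 huK
  have hul : ∀ l : K, u + l ≠ 0 := fun l h => hu <| by
    rw [eq_neg_of_add_eq_zero_left h]; exact K.neg_mem l.2
  -- With z = y^(q-1), the polynomial becomes y^(q^2) + αy^q + βy = 0 for y ≠ 0. Choosing α, β so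
  -- that 1 and u are solutions makes their whole K-span solutions; `g l` comes from y = u + l, and
  -- the root 1 from y = 1.
  let g : K → F := fun l => (v + l) / (u + l)
  have hg : Function.Injective g := fun x y h => by
    simp only [g] at h
    rw [div_eq_div_iff (hul x) (hul y)] at h
    have h' : (v - u) * ((x : F) - y) = 0 := by linear_combination -h
    exact Subtype.ext (sub_eq_zero.1 ((mul_eq_zero.1 h').resolve_left hvu))
  have h1 : (1 : F) ∉ Finset.univ.image g := fun h => by
    obtain ⟨l, -, hl⟩ := Finset.mem_image.1 h
    simp only [g] at hl
    rw [div_eq_one_iff_eq (hul l), add_left_inj] at hl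
    exact huK hl
  refine ⟨-((w - u) / (v - u)), (w - u) / (v - u) - 1,
    neg_ne_zero.2 (div_ne_zero (sub_ne_zero.2 hu2) hvu), insert 1 (Finset.univ.image g), ?_, ?_⟩
  · rw [Finset.card_insert_of_notMem h1, Finset.card_image_of_injective _ hg,
      Finset.card_univ, Nat.card_eq_fintype_card]
  · intro z hz
    rcases Finset.mem_insert.1 hz with rfl | hz
    · rw [one_pow]; ring
    obtain ⟨l, -, rfl⟩ := Finset.mem_image.1 hz
    have hvl : v + l ≠ 0 := by
      rw [hv, ← hK l l.2, ← add_pow_char_pow]; exact pow_ne_zero _ (hul l)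
    have hgp : g l ^ 2 ^ k = (w + l) / (v + l) := by
      simp only [g]
      rw [div_pow, add_pow_char_pow, add_pow_char_pow, hK l l.2]
    rw [pow_succ, hgp]
    simp only [g]
    have := hul l
    field_simp
    ring

lemma le_cDiffUniformity_goldFun [Fintype F] [CharP F 2] {k : ℕ} {c α β : F} (hα : α ≠ 0)
    (hc : c ^ 2 ^ k ≠ c) (Z : Finset F)
    (hZ : ∀ z ∈ Z, z ^ (2 ^ k + 1) + α * z + β = 0) :
    Z.card ≤ cDiffUniformity (goldFun F k) c := by
  classical
  have hc1 : 1 - c ≠ 0 := fun h => hc (by rw [← sub_eq_zero.1 h, one_pow])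
  -- In x = s z + t, this t kills the z^q term; s then scales the z coefficient to α.
  obtain ⟨t, ht⟩ : ∃ t : F, (1 - c) * t = -1 := ⟨-(1 - c)⁻¹, by field_simp⟩
  have htq : (1 - c ^ 2 ^ k) * t ^ 2 ^ k = -1 := by
    have := congrArg (· ^ 2 ^ k) ht
    simp only [mul_pow, sub_pow_char_pow, one_pow] at this
    rw [this, CharTwo.neg_eq, one_pow]
  have hA : (1 - c) * t ^ 2 ^ k + 1 ≠ 0 := fun h => by
    have ht0 : t ^ 2 ^ k ≠ 0 := fun h0 => by simp [h0] at h
    have : t ^ 2 ^ k * (c ^ 2 ^ k - c) = 0 := by linear_combination h - htq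
    exact hc (sub_eq_zero.1 ((mul_eq_zero.1 this).resolve_left ht0))
  obtain ⟨s, hs⟩ : ∃ s : F, s ^ 2 ^ k = ((1 - c) * t ^ 2 ^ k + 1) / ((1 - c) * α) :=
    (bijective_iterateFrobenius F 2 k).2 _
  have hs0 : s ≠ 0 := by
    rintro rfl
    rw [zero_pow (by positivity)] at hs
    exact div_ne_zero hA (mul_ne_zero hc1 hα) hs.symm
  have hsα : s ^ 2 ^ k * ((1 - c) * α) = (1 - c) * t ^ 2 ^ k + 1 := by
    rw [hs, div_mul_cancel₀ _ (mul_ne_zero hc1 hα)]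
  have hinj : Function.Injective fun z : F => s * z + t := fun x y h => by
    simpa [hs0] using h
  rw [← Finset.card_image_of_injective Z hinj]
  refine le_trans ?_ (cDiffCount_le_cDiffUniformity (a := 1) (goldFun F k)
    ((1 - c) * s ^ (2 ^ k + 1) * (-β) + (1 - c) * t ^ (2 ^ k + 1) + t ^ 2 ^ k + t + 1)
    fun _ => one_ne_zero)
  refine Finset.card_le_card fun x hx => ?_
  obtain ⟨z, hz, rfl⟩ := Finset.mem_image.1 hx
  have h := hZ z hz
  simp only [Finset.mem_filter, Finset.mem_univ, true_and, cDerivative_goldFun]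
  simp only [pow_succ _ (2 ^ k), add_pow_char_pow, mul_pow, one_pow] at h ⊢
  linear_combination (1 - c) * s ^ 2 ^ k * s * h + s ^ 2 ^ k * z ^ 2 ^ k * ht - s * z * hsα

/-! ### Roots of unity and Frobenius-fixed c -/

lemma card_pow_eq_one [Fintype F] [DecidableEq F] {N : ℕ} (hN : N ≠ 0) :
    (Finset.univ.filter fun x : F => x ^ N = 1).card = Nat.gcd (Fintype.card F - 1) N := by
  have h : (Finset.univ.filter fun x : F => x ^ N = 1) =
      (Finset.univ.filter fun x : Fˣ => x ^ N = 1).map ⟨Units.val, Units.val_injective⟩ := by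
    ext x
    simp only [Finset.mem_filter, Finset.mem_univ, true_and, Finset.mem_map,
      Function.Embedding.coeFn_mk]
    constructor
    · intro hx
      exact ⟨Units.ofPowEqOne x N hx hN, Units.ext (by simp), rfl⟩
    · rintro ⟨y, hy, rfl⟩
      rw [← Units.val_pow_eq_pow_val, hy, Units.val_one]
  rw [h, Finset.card_map, ← Fintype.card_units, ← Nat.card_eq_fintype_card,
    ← IsCyclic.card_powMonoidHom_ker, ← Fintype.card_subtype, ← Nat.card_eq_fintype_card]
  rfl

/-- 2^k + 1 and 2^k - 1 are coprime with product 2^(2k) - 1, so their gcds with 2^n - 1 multiply. -/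
lemma gcd_two_pow_add_one_mul {k : ℕ} (hk : k ≠ 0) (n : ℕ) :
    Nat.gcd (2 ^ n - 1) (2 ^ k + 1) * (2 ^ Nat.gcd k n - 1) = 2 ^ Nat.gcd (2 * k) n - 1 := by
  have hcop : Nat.Coprime (2 ^ k + 1) (2 ^ k - 1) := by
    have hodd : Odd (2 ^ k - 1) :=
      Nat.Even.sub_odd Nat.one_le_two_pow ((even_two).pow_of_ne_zero hk) odd_one
    have h : 2 ^ k + 1 = 2 + (2 ^ k - 1) := by have := Nat.one_le_two_pow (n := k); omega
    rw [h, Nat.coprime_add_self_left, Nat.coprime_two_left]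
    exact hodd
  rw [Nat.gcd_comm k, Nat.gcd_comm (2 * k), ← Nat.pow_sub_one_gcd_pow_sub_one,
    ← Nat.pow_sub_one_gcd_pow_sub_one, ← Nat.Coprime.gcd_mul _ hcop]
  congr 1
  rw [mul_comm 2 k, pow_mul]
  simpa using (Nat.sq_sub_sq (2 ^ k) 1).symm

/-- For `c ≠ 1` fixed by the `2 ^ k`-Frobenius, the `c`-differential uniformity of the Gold
function is the number of `(2 ^ k + 1)`-th roots of unity. -/
lemma cDiffUniformity_goldFun_of_pow_eq [Fintype F] [CharP F 2] {k : ℕ} {c : F} (hc1 : c ≠ 1)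
    (hc : c ^ 2 ^ k = c) :
    cDiffUniformity (goldFun F k) c = Nat.gcd (Fintype.card F - 1) (2 ^ k + 1) := by
  classical
  have he : 1 - c ≠ 0 := sub_ne_zero.2 hc1.symm
  rw [← card_pow_eq_one (F := F) (Nat.succ_ne_zero _)]
  apply le_antisymm
  · refine cDiffUniformity_le fun a b => ?_
    obtain ⟨t, ht⟩ : ∃ t : F, (1 - c) * t = a := ⟨(1 - c)⁻¹ * a, by field_simp⟩
    have htq : (1 - c) * t ^ 2 ^ k = a ^ 2 ^ k := by
      rw [← ht, mul_pow, sub_pow_char_pow, one_pow, hc]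
    have key : ∃ C : F, ∀ x, cDerivative (goldFun F k) c a x = b ↔
        (x + t) ^ (2 ^ k + 1) = C := by
      refine ⟨(1 - c)⁻¹ * (b - a ^ (2 ^ k + 1) + (1 - c) * t ^ (2 ^ k + 1)), fun x => ?_⟩
      rw [cDerivative_goldFun, eq_inv_mul_iff_mul_eq₀ he]
      simp only [pow_succ _ (2 ^ k), add_pow_char_pow]
      constructor <;> intro h
      · linear_combination h + x ^ 2 ^ k * ht + x * htq
      · linear_combination h - x ^ 2 ^ k * ht - x * htq
    obtain ⟨C, hC⟩ := key
    unfold cDiffCount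
    simp only [hC]
    rcases (Finset.univ.filter fun x : F => (x + t) ^ (2 ^ k + 1) = C).eq_empty_or_nonempty
      with h | ⟨z, hz⟩
    · rw [h]; simp
    have hz' : (z + t) ^ (2 ^ k + 1) = C := (Finset.mem_filter.1 hz).2
    rcases eq_or_ne (z + t) 0 with h0 | h0
    · have hC0 : C = 0 := by rw [← hz', h0, zero_pow (Nat.succ_ne_zero _)]
      refine (Finset.card_le_one.2 fun x hx y hy => ?_).trans
        (Finset.card_pos.2 ⟨1, by simp⟩)
      simp only [Finset.mem_filter, Finset.mem_univ, true_and, hC0,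
        pow_eq_zero_iff (Nat.succ_ne_zero _)] at hx hy
      exact add_right_cancel (hx.trans hy.symm)
    · refine Finset.card_le_card_of_injOn (fun x => (x + t) / (z + t)) (fun x hx => ?_)
        (fun x _ y _ h => ?_)
      · have hx' : (x + t) ^ (2 ^ k + 1) = C := by simpa using hx
        have : C ≠ 0 := hz' ▸ pow_ne_zero _ h0
        simp [div_pow, hx', hz', this]
      · simpa [div_left_inj' h0] using h
  · refine le_trans ?_ (cDiffCount_le_cDiffUniformity (a := 0) (goldFun F k) (1 - c)
      fun h => (hc1 h).elim)
    refine Finset.card_le_card fun x hx => ?_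
    have hx' : x ^ (2 ^ k + 1) = 1 := by simpa using hx
    simp [cDerivative_goldFun, hx']

/-! ### Fixed fields of Frobenius powers -/

lemma pow_two_pow_eq_self_iff [Fintype F] {n : ℕ} (hF : Fintype.card F = 2 ^ n) (j : ℕ) (x : F) :
    x ^ 2 ^ j = x ↔ x ^ 2 ^ Nat.gcd n j = x := by
  rcases eq_or_ne x 0 with rfl | hx
  · simp
  have h : ∀ i : ℕ, x ^ 2 ^ i = x ↔ x ^ (2 ^ i - 1) = 1 := fun i => by
    rw [← mul_left_inj' hx (a := x ^ (2 ^ i - 1)), ← pow_succ, one_mul,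
      Nat.sub_add_cancel Nat.one_le_two_pow]
  rw [h, h, ← Nat.pow_sub_one_gcd_pow_sub_one, ← orderOf_dvd_iff_pow_eq_one,
    ← orderOf_dvd_iff_pow_eq_one, Nat.dvd_gcd_iff, orderOf_dvd_iff_pow_eq_one (n := 2 ^ n - 1)]
  simp [← hF, FiniteField.pow_card_sub_one_eq_one x hx]

lemma card_pow_two_pow_eq_self_le [Fintype F] [DecidableEq F] {j : ℕ} (hj : j ≠ 0) :
    (Finset.univ.filter fun x : F => x ^ 2 ^ j = x).card ≤ 2 ^ j := by
  have h2 : 1 < 2 ^ j := Nat.one_lt_two_pow hj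
  have hsub : (Finset.univ.filter fun x : F => x ^ 2 ^ j = x) ⊆
      (Polynomial.X ^ 2 ^ j - Polynomial.X : Polynomial F).roots.toFinset := fun x hx => by
    simp only [Finset.mem_filter, Finset.mem_univ, true_and] at hx
    simp [FiniteField.X_pow_card_sub_X_ne_zero F h2, hx]
  calc _ ≤ _ := Finset.card_le_card hsub
    _ ≤ _ := Multiset.toFinset_card_le _
    _ ≤ _ := Polynomial.card_roots' _
    _ = 2 ^ j := FiniteField.X_pow_card_sub_X_natDegree_eq F h2

/-- K lies in the fixed set, which is no larger than K. -/
lemma mem_subfield_iff_pow_eq_self [Fintype F] {n k : ℕ} (hk : k ≠ 0)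
    (hF : Fintype.card F = 2 ^ n) (K : Subfield F) (hK : Nat.card K = 2 ^ Nat.gcd n k) (x : F) :
    x ∈ K ↔ x ^ 2 ^ k = x := by
  classical
  have := Fintype.ofFinite K
  rw [Nat.card_eq_fintype_card] at hK
  rw [pow_two_pow_eq_self_iff hF]
  have hsub : Finset.univ.map ⟨((↑) : K → F), Subtype.val_injective⟩ ⊆
      Finset.univ.filter fun x : F => x ^ 2 ^ Nat.gcd n k = x := fun y hy => by
    obtain ⟨l, -, rfl⟩ := Finset.mem_map.1 hy
    simp only [Finset.mem_filter, Finset.mem_univ, true_and, Function.Embedding.coeFn_mk]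
    rw [← hK, ← SubmonoidClass.coe_pow, FiniteField.pow_card]
  have heq := Finset.eq_of_subset_of_card_le hsub (by
    rw [Finset.card_map, Finset.card_univ, hK]
    exact card_pow_two_pow_eq_self_le (Nat.gcd_ne_zero_right hk))
  have := Finset.ext_iff.1 heq x
  simpa using this

lemma exists_pow_two_pow_ne_self [Fintype F] {n j : ℕ} (hF : Fintype.card F = 2 ^ n)
    (hj : 0 < j) (h : Nat.gcd n j < n) : ∃ u : F, u ^ 2 ^ j ≠ u := by
  classical
  by_contra! hall
  have h1 := card_pow_two_pow_eq_self_le (F := F) (j := Nat.gcd n j)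
    (Nat.gcd_pos_of_pos_right n hj).ne'
  rw [Finset.filter_true_of_mem fun x _ => (pow_two_pow_eq_self_iff hF j x).1 (hall x),
    Finset.card_univ, hF] at h1
  exact (Nat.pow_lt_pow_right one_lt_two h).not_ge h1

lemma cDiffUniformity_goldFun_of_notMem [Fintype F] [CharP F 2] {n k : ℕ} (hk : 0 < k)
    (hF : Fintype.card F = 2 ^ n) (K : Subfield F) (hK : Nat.card K = 2 ^ Nat.gcd n k)
    (hn : 2 * Nat.gcd n k < n) {c : F} (hc : c ∉ K) :
    cDiffUniformity (goldFun F k) c = 2 ^ Nat.gcd n k + 1 := by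
  classical
  have hmem := mem_subfield_iff_pow_eq_self hk.ne' hF K hK
  have hc1 : 1 - c ≠ 0 := fun h => hc (by rw [← sub_eq_zero.1 h]; exact K.one_mem)
  apply le_antisymm
  · rw [← hK]
    refine cDiffUniformity_le fun a b => ?_
    refine card_projective_poly_le (k := k) (A := a) (B := a ^ 2 ^ k)
      (C := b - a ^ (2 ^ k + 1)) K (fun x => (hmem x).2) hc1 _ fun x hx => ?_
    simp only [Finset.mem_filter, Finset.mem_univ, true_and, cDerivative_goldFun] at hx
    linear_combination hx
  -- As gcd(n, 2k) ≤ 2 gcd(n, k) < n, some u has u^(q^2) ≠ u.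
  · have hgcd : Nat.gcd n (2 * k) < n := by
      refine (Nat.le_of_dvd (by positivity) ?_).trans_lt hn
      rw [← Nat.gcd_mul_left]
      exact Nat.gcd_dvd_gcd_of_dvd_left _ (Dvd.intro_left 2 rfl)
    obtain ⟨u, hu⟩ := exists_pow_two_pow_ne_self hF (by positivity) hgcd
    rw [two_mul, pow_add, pow_mul] at hu
    have huK : u ^ 2 ^ k ≠ u := fun h => hu (by rw [h, h])
    obtain ⟨α, β, hα, Z, hZ, hroot⟩ := exists_projective_poly_card K (fun x => (hmem x).1)
      (fun h => huK ((hmem u).1 h)) huK hu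
    rw [← hK, ← hZ]
    exact le_cDiffUniformity_goldFun hα (fun h => hc ((hmem c).2 h)) Z hroot

/-- For c = a = b = 1 the equation is x^q + x = 0, solved by all of K; hence APN forces d = 1. -/
lemma card_le_cDiffUniformity_goldFun_one [Fintype F] [CharP F 2] {k : ℕ} (K : Subfield F)
    (hK : ∀ x ∈ K, x ^ 2 ^ k = x) : Nat.card K ≤ cDiffUniformity (goldFun F k) 1 := by
  classical
  have := Fintype.ofFinite K
  refine le_trans ?_ (cDiffCount_le_cDiffUniformity (a := 1) (goldFun F k) 1
    fun _ => one_ne_zero)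
  rw [Nat.card_eq_fintype_card, ← Finset.card_univ,
    ← Finset.card_map ⟨((↑) : K → F), Subtype.val_injective⟩]
  refine Finset.card_le_card fun x hx => ?_
  obtain ⟨l, -, rfl⟩ := Finset.mem_map.1 hx
  simp [cDerivative_goldFun, hK l l.2, CharTwo.add_self_eq_zero]

end GoldFunction

theorem mainTheorem1 (n k d m : ℕ) (hk : 2 ≤ k) (hkn : k < n)
    (hd : d = Nat.gcd n k) (hn : n = m * d) (hm : 3 ≤ m)
    (F : Type*) [Field F] [Fintype F] (hF : Fintype.card F = 2 ^ n)
    (K : Subfield F) (hK : Nat.card K = 2 ^ d) :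
    (∀ c ∈ K, c ≠ 1 →
      (cDiffUniformity (goldFun F k) c : ℚ) =
        (2 ^ Nat.gcd (2 * k) n - 1) / (2 ^ Nat.gcd k n - 1)) ∧
    (∀ c ∉ K, cDiffUniformity (goldFun F k) c = 2 ^ d + 1) ∧
    (IsAPN (goldFun F k) →
      (∀ c : F, c ≠ 0 → c ≠ 1 → IsCUniform (goldFun F k) c 3) ∧
      (Even n → IsCUniform (goldFun F k) 0 3) ∧
      (Odd n → IsCUniform (goldFun F k) 0 1)) := by
  have hk0 : 0 < k := by omega
  have hn0 : n ≠ 0 := by omega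
  have : CharP F 2 := charP_of_card_eq_prime_pow hF
  subst hd
  have hd0 : 0 < Nat.gcd n k := Nat.gcd_pos_of_pos_right n hk0
  have hlt : 2 * Nat.gcd n k < n := by nlinarith
  have hmem := mem_subfield_iff_pow_eq_self hk0.ne' hF K hK
  have part1 : ∀ c ∈ K, c ≠ 1 →
      cDiffUniformity (goldFun F k) c * (2 ^ Nat.gcd k n - 1) = 2 ^ Nat.gcd (2 * k) n - 1 := by
    intro c hc hc1
    rw [cDiffUniformity_goldFun_of_pow_eq hc1 ((hmem c).1 hc), hF, gcd_two_pow_add_one_mul hk0.ne']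
  have part2 : ∀ c ∉ K, cDiffUniformity (goldFun F k) c = 2 ^ Nat.gcd n k + 1 :=
    fun c hc => cDiffUniformity_goldFun_of_notMem hk0 hF K hK hlt hc
  refine ⟨fun c hc hc1 => ?_, part2, fun hAPN => ?_⟩
  · have hpos : 0 < Nat.gcd k n := Nat.gcd_pos_of_pos_left n hk0
    have h1 : (1 : ℚ) < 2 ^ Nat.gcd k n := one_lt_pow₀ one_lt_two hpos.ne'
    rw [eq_div_iff (by linarith)]
    have h := congrArg (Nat.cast : ℕ → ℚ) (part1 c hc hc1)
    push_cast [Nat.one_le_two_pow] at h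
    exact h
  · have hle := card_le_cDiffUniformity_goldFun_one K fun x => (hmem x).1
    have hAPN' : cDiffUniformity (goldFun F k) 1 = 2 := hAPN
    rw [hAPN', hK] at hle
    have hd1 : Nat.gcd n k = 1 := by
      by_contra h
      have := Nat.pow_le_pow_right two_pos (show 2 ≤ Nat.gcd n k by omega)
      omega
    have hd1' : Nat.gcd k n = 1 := by rw [Nat.gcd_comm, hd1]
    rw [hd1] at hK part2
    have h0 := part1 0 K.zero_mem zero_ne_one
    rw [hd1'] at h0
    refine ⟨fun c hc0 hc1 => part2 c fun hc => ?_, fun hn2 => ?_, fun hn2 => ?_⟩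
    -- With d = 1, K is {0, 1}, so every other c falls under the second case.
    · have h2 : ∀ x ∈ K, x ^ 2 = x := fun x hx => by
        have := (pow_two_pow_eq_self_iff hF k x).1 ((hmem x).1 hx)
        rwa [hd1, pow_one] at this
      have : c * (c - 1) = 0 := by linear_combination h2 c hc
      exact (mul_eq_zero.1 this).elim hc0 fun h => hc1 (sub_eq_zero.1 h)
    · have hg : Nat.gcd (2 * k) n = 2 := by
        rw [Nat.Coprime.gcd_mul_right_cancel _ hd1']
        exact Nat.gcd_eq_left hn2.two_dvd
      rw [hg] at h0
      simpa [IsCUniform] using h0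
    · have hg : Nat.gcd (2 * k) n = 1 := by
        rw [Nat.Coprime.gcd_mul_left_cancel _ (Nat.coprime_two_left.2 hn2), hd1']
      rw [hg] at h0
      simpa [IsCUniform] using h0
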